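/- Let $G_1=\langle x_1\rangle$ and $G_2=\langle x_2\rangle$ be nontrivial finite cyclic groups of coprime orders, let $C_1=\langle c_1\rangle$ and $C_2=\langle c_2\rangle$ be infinite cyclic groups, and let $G=(G_1\times C_1)*(G_2\times C_2)$ be the free product. For $i=1,2$ let $F_i$ be the free group on two generators $X_i,Y_i$, and let $\varphi_i\colon F_i\twoheadrightarrow G_i\times C_i$ be the epimorphism with $X_i\mapsto (x_i,1)$ and $Y_i\mapsto (1,c_i)$. Let $F=F_1*F_2$, let $\varphi=\varphi_1*\varphi_2\colon F\twoheadrightarrow G$ be the induced epimorphism, and let $R=\ker\varphi$. Let $R'=[R,R]$ and regard the abelian group $R/R'$ as a $\mathbb{Z}G$-module, where $G\cong F/R$ acts by conjugation in $F$. Then the minimal number $d_G(R/R')$ of generators of $R/R'$ as a $\mathbb{Z}G$-module satisfies \[ d_G(R/R')=3 . \] -/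

import Mathlib

/-!
Relation modules of free presentations, and the free presentation of a free product
`(G₁ × C₁) * (G₂ × C₂)` built from two-generator presentations of the factors.
-/

namespace RelationModule

section General

variable {F G : Type*} [Group F] [Group G]

/-- Conjugation by elements of `F` on `R / R'`, where `R` is the kernel of `φ : F →* G`. -/
def conjAb (φ : F →* G) : F →* MulAut (Abelianization φ.ker) where
  toFun f := (MulAut.conjNormal (H := φ.ker) f).abelianizationCongr
  map_one' := by
    ext x
    induction x using QuotientGroup.induction_on with
    | H r => rw [map_one]; rfl
  map_mul' f₁ f₂ := by
    ext x
    induction x using QuotientGroup.induction_on with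
    | H r => rw [map_mul]; rfl

theorem conjAb_of (φ : F →* G) (f : F) (r : φ.ker) :
    conjAb φ f (Abelianization.of r) = Abelianization.of (MulAut.conjNormal f r) :=
  rfl

/-- The kernel `R` acts trivially on `R / R'`. -/
theorem ker_le_ker_conjAb (φ : F →* G) : φ.ker ≤ (conjAb φ).ker := by
  intro s hs
  rw [MonoidHom.mem_ker]
  ext x
  induction x using QuotientGroup.induction_on with
  | H r =>
    have h : MulAut.conjNormal s r = (⟨s, hs⟩ : φ.ker) * r * (⟨s, hs⟩ : φ.ker)⁻¹ := by
      ext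
      simp
    change Abelianization.of (MulAut.conjNormal s r) = Abelianization.of r
    rw [h, map_mul, map_mul, map_inv, mul_comm, inv_mul_cancel_left]

/-- For a surjection `φ : F →* G` with kernel `R`, the action of `G` on `R / R'` induced by
conjugation in `F`. -/
noncomputable def action (φ : F →* G) (hφ : Function.Surjective φ) :
    G →* MulAut (Abelianization φ.ker) :=
  φ.liftOfSurjective hφ ⟨conjAb φ, ker_le_ker_conjAb φ⟩

theorem action_apply_of (φ : F →* G) (hφ : Function.Surjective φ) (f : F) (r : φ.ker) :
    action φ hφ (φ f) (Abelianization.of r) = Abelianization.of (MulAut.conjNormal f r) := by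
  have h : action φ hφ (φ f) = conjAb φ f :=
    φ.liftOfRightInverse_comp_apply _ (Function.rightInverse_surjInv hφ)
      ⟨conjAb φ, ker_le_ker_conjAb φ⟩ f
  rw [h, conjAb_of]

/-- The abelian group `R / R'`, written additively, as an integral representation of `G`. -/
noncomputable def rep (φ : F →* G) (hφ : Function.Surjective φ) :
    Representation ℤ G (Additive (Abelianization φ.ker)) where
  toFun g := (MonoidHom.toAdditive (action φ hφ g).toMonoidHom).toIntLinearMap
  map_one' := by
    ext x
    simp
  map_mul' g₁ g₂ := by
    ext x
    simp

theorem rep_apply_of (φ : F →* G) (hφ : Function.Surjective φ) (f : F) (r : φ.ker) :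
    rep φ hφ (φ f) (Additive.ofMul (Abelianization.of r)) =
      Additive.ofMul (Abelianization.of (MulAut.conjNormal f r)) :=
  congrArg Additive.ofMul (action_apply_of φ hφ f r)

/-- `d_G(R / R')`: the minimal number of generators of the relation module `R / R'` as a module
over the integral group ring `ℤ[G]`. -/
noncomputable def minGenerators (φ : F →* G) (hφ : Function.Surjective φ) : Cardinal :=
  (⊤ : Submodule (MonoidAlgebra ℤ G) (rep φ hφ).asModule).spanRank

end General

section Presentation

/-- The two-generator presentation of `A × C` given by `x ∈ A` and `c ∈ C`: the free group of
rank two is mapped to `A × C` by sending the free generators to `(x, 1)` and `(1, c)`. -/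
def factorHom {A C : Type*} [Group A] [Group C] (x : A) (c : C) : FreeGroup (Fin 2) →* A × C :=
  FreeGroup.lift ![(x, 1), (1, c)]

theorem factorHom_surjective {A C : Type*} [Group A] [Group C] {x : A} {c : C}
    (hx : Subgroup.zpowers x = ⊤) (hc : Subgroup.zpowers c = ⊤) :
    Function.Surjective (factorHom x c) := by
  rintro ⟨a, b⟩
  obtain ⟨m, rfl⟩ := Subgroup.mem_zpowers_iff.1 (hx ▸ Subgroup.mem_top a)
  obtain ⟨n, rfl⟩ := Subgroup.mem_zpowers_iff.1 (hc ▸ Subgroup.mem_top b)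
  exact ⟨FreeGroup.of 0 ^ m * FreeGroup.of 1 ^ n, by simp [factorHom]⟩

theorem coprodMap_surjective {F₁ F₂ H₁ H₂ : Type*} [Group F₁] [Group F₂] [Group H₁] [Group H₂]
    {φ₁ : F₁ →* H₁} {φ₂ : F₂ →* H₂}
    (h₁ : Function.Surjective φ₁) (h₂ : Function.Surjective φ₂) :
    Function.Surjective (Monoid.Coprod.map φ₁ φ₂) := by
  intro y
  induction y using Monoid.Coprod.induction_on with
  | inl a =>
    obtain ⟨f, rfl⟩ := h₁ a
    exact ⟨Monoid.Coprod.inl f, by simp⟩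
  | inr b =>
    obtain ⟨f, rfl⟩ := h₂ b
    exact ⟨Monoid.Coprod.inr f, by simp⟩
  | mul a b ha hb =>
    obtain ⟨u, rfl⟩ := ha
    obtain ⟨v, rfl⟩ := hb
    exact ⟨u * v, map_mul _ _ _⟩

end Presentation

end RelationModule

/-!
Write `n` and `m` for the orders of `x₁` and `x₂`. The relation module is generated by the classes
`ρᵢ` of the power relators and `κᵢ` of the commutator relators `[Yᵢ, Xᵢ]`, subject to `xᵢ ρᵢ = ρᵢ`
and `(cᵢ - 1) ρᵢ = Nᵢ κᵢ`, where `N₁ = 1 + x₁ + ⋯ + x₁ⁿ⁻¹` and likewise for `N₂`.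

For the upper bound, choose `q` and `s` with `1 + n q = m s`. Modulo `κ₁ - q ρ₁` the unit `c₁`
multiplies `ρ₁` by `m s`, whereas `ρ₂ + (m - N₂) κ₂ = 0` forces `m² κ₂ = 0`. Identifying `κ₂` with
`-ρ₁` therefore gives `c₁² ρ₁ = (m s)² ρ₁ = 0`, and everything vanishes.

For the lower bound, `ρ₁`, `ρ₂` and `κ₁` remain independent modulo `n` in `R / [F, R]`: exponent
sums divided by `n` and `m` detect `ρ₁` and `ρ₂`, and the corner entry of the Heisenberg group over
`ℤ / n`, in which `[Y₁, X₁]` becomes a generator of the centre, detects `κ₁`.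
-/

namespace RelationModule

open scoped commutatorElement

section RelatorPair

variable {A M M' : Type*} [Ring A] [AddCommGroup M'] [Module A M'] [AddCommGroup M] [Module A M]

/-- The module relations satisfied by the classes `ρ` of a power relator `Xⁿ` and `κ` of a
commutator relator `[Y, X]`, where `x` and `c` stand for the actions of `X` and `Y`. -/
structure IsRelatorPair (n : ℕ) (x c : A) (ρ κ : M) : Prop where
  pow_eq_one : x ^ n = 1
  smul_power : x • ρ = ρ
  smul_power_eq_add : c • ρ = (∑ i ∈ Finset.range n, x ^ i) • κ + ρ

theorem geomSum_smul_of_smul_eq {x : A} {v : M} (n : ℕ) (h : x • v = v) :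
    (∑ i ∈ Finset.range n, x ^ i) • v = n • v := by
  have pow_smul_eq (i : ℕ) : x ^ i • v = v := by
    induction i with
    | zero => simp
    | succ i ih => rw [pow_succ, mul_smul, h, ih]
  simp [Finset.sum_smul, pow_smul_eq]

namespace IsRelatorPair

variable {n m : ℕ} {x c x₁ c₁ x₂ c₂ : A} {ρ κ ρ₁ κ₁ ρ₂ κ₂ : M}

theorem map (h : IsRelatorPair n x c ρ κ) (f : M →ₗ[A] M') :
    IsRelatorPair n x c (f ρ) (f κ) where
  pow_eq_one := h.pow_eq_one
  smul_power := by rw [← map_smul, h.smul_power]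
  smul_power_eq_add := by rw [← map_smul, h.smul_power_eq_add, map_add, map_smul]

theorem smul_power_eq_zsmul (h : IsRelatorPair n x c ρ κ) {q : ℤ} (hκ : κ = q • ρ) :
    c • ρ = (1 + n * q) • ρ := by
  rw [h.smul_power_eq_add, hκ, smul_comm, geomSum_smul_of_smul_eq n h.smul_power,
    add_smul, one_smul, mul_comm, mul_smul, natCast_zsmul, add_comm]

theorem geomSum_smul_geomSum_smul (h : IsRelatorPair n x c ρ κ) :
    (∑ i ∈ Finset.range n, x ^ i) • (∑ i ∈ Finset.range n, x ^ i) • κ =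
      n • (∑ i ∈ Finset.range n, x ^ i) • κ := by
  refine geomSum_smul_of_smul_eq n ?_
  have mul_sum_eq : x * ∑ i ∈ Finset.range n, x ^ i = ∑ i ∈ Finset.range n, x ^ i := by
    rw [← sub_eq_zero, ← sub_one_mul, mul_geom_sum, h.pow_eq_one, sub_self]
  rw [← mul_smul, mul_sum_eq]

theorem nsmul_nsmul_eq_zero (h : IsRelatorPair n x c ρ κ)
    (hρ : ρ + (n • κ - (∑ i ∈ Finset.range n, x ^ i) • κ) = 0) : n • n • κ = 0 := by
  set N := ∑ i ∈ Finset.range n, x ^ i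
  have nsmul_ρ : n • ρ = 0 := by
    rw [← geomSum_smul_of_smul_eq n h.smul_power, eq_neg_of_add_eq_zero_left hρ, smul_neg,
      smul_sub, h.geomSum_smul_geomSum_smul, smul_comm, sub_self, neg_zero]
  have nsmul_Nκ : n • N • κ = 0 := by
    rw [eq_sub_of_add_eq h.smul_power_eq_add.symm, smul_sub, smul_comm, nsmul_ρ, smul_zero,
      sub_zero]
  have nsmul_hρ : n • (ρ + (n • κ - N • κ)) = 0 := by rw [hρ, smul_zero]
  rwa [smul_add, smul_sub, nsmul_ρ, nsmul_Nκ, zero_add, sub_zero] at nsmul_hρ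

theorem eq_zero_of_combinations (h₁ : IsRelatorPair n x₁ c₁ ρ₁ κ₁)
    (h₂ : IsRelatorPair m x₂ c₂ ρ₂ κ₂) (hc₁ : IsUnit c₁) {q s : ℤ} (hqs : 1 + n * q = m * s)
    (w₁ : κ₁ - q • ρ₁ = 0) (w₂ : ρ₂ + (m • κ₂ - (∑ i ∈ Finset.range m, x₂ ^ i) • κ₂) = 0)
    (w₃ : κ₂ + ρ₁ = 0) : ρ₁ = 0 ∧ κ₁ = 0 ∧ ρ₂ = 0 ∧ κ₂ = 0 := by
  have m_sq_smul_ρ₁ : m • m • ρ₁ = 0 := by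
    rw [eq_neg_of_add_eq_zero_right w₃, smul_neg, smul_neg, h₂.nsmul_nsmul_eq_zero w₂, neg_zero]
  have c₁_smul_ρ₁ : c₁ • ρ₁ = s • m • ρ₁ := by
    rw [h₁.smul_power_eq_zsmul (sub_eq_zero.1 w₁), hqs, mul_comm, mul_smul, natCast_zsmul]
  have c₁_sq_smul_ρ₁ : c₁ • c₁ • ρ₁ = 0 := by
    rw [c₁_smul_ρ₁, smul_comm c₁, smul_comm c₁, c₁_smul_ρ₁, smul_comm m s, m_sq_smul_ρ₁,
      smul_zero, smul_zero]
  have ρ₁_eq_zero : ρ₁ = 0 := by rwa [hc₁.smul_eq_zero, hc₁.smul_eq_zero] at c₁_sq_smul_ρ₁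
  have κ₂_eq_zero : κ₂ = 0 := by simpa [ρ₁_eq_zero] using w₃
  exact ⟨ρ₁_eq_zero, by simpa [ρ₁_eq_zero] using w₁, by simpa [κ₂_eq_zero] using w₂, κ₂_eq_zero⟩

theorem spanRank_le_three (h₁ : IsRelatorPair n x₁ c₁ ρ₁ κ₁) (h₂ : IsRelatorPair m x₂ c₂ ρ₂ κ₂)
    (hc₁ : IsUnit c₁) (hcop : n.Coprime m)
    (hspan : Submodule.span A {ρ₁, κ₁, ρ₂, κ₂} = ⊤) : (⊤ : Submodule A M).spanRank ≤ 3 := by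
  classical
  obtain ⟨q, s, hqs⟩ : ∃ q s : ℤ, 1 + n * q = m * s := by
    obtain ⟨a, b, hab⟩ := Nat.isCoprime_iff_coprime.2 hcop
    exact ⟨-a, b, by linear_combination -hab⟩
  let T : Finset M :=
    {κ₁ - q • ρ₁, ρ₂ + (m • κ₂ - (∑ i ∈ Finset.range m, x₂ ^ i) • κ₂), κ₂ + ρ₁}
  let W := Submodule.span A (T : Set M)
  have mkQ_eq_zero (w : M) (hw : w ∈ T) : W.mkQ w = 0 :=
    (Submodule.Quotient.mk_eq_zero W).2 (Submodule.subset_span hw)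
  have mkQ_relators := (h₁.map W.mkQ).eq_zero_of_combinations (h₂.map W.mkQ) hc₁ hqs
    (by rw [← map_zsmul, ← map_sub]; exact mkQ_eq_zero _ (by simp [T]))
    (by rw [← map_nsmul, ← map_smul, ← map_sub, ← map_add]; exact mkQ_eq_zero _ (by simp [T]))
    (by rw [← map_add]; exact mkQ_eq_zero _ (by simp [T]))
  have W_eq_top : W = ⊤ := by
    rw [eq_top_iff, ← hspan, Submodule.span_le]
    simpa [Set.insert_subset_iff] using mkQ_relators
  calc (⊤ : Submodule A M).spanRank = W.spanRank := by rw [W_eq_top]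
    _ ≤ Cardinal.mk (T : Set M) := Submodule.spanRank_span_le_card _
    _ = (T.card : Cardinal) := by simp
    _ ≤ 3 := by exact_mod_cast Finset.card_le_three

end IsRelatorPair

end RelatorPair

section RelationClass

variable {F G : Type*} [Group F] [Group G]

/-- The class in the relation module `R / R'` of an element of the kernel `R`. -/
noncomputable def relationClass (φ : F →* G) (hφ : Function.Surjective φ) :
    Additive φ.ker →+ (rep φ hφ).asModule :=
  (rep φ hφ).asModuleEquiv.symm.toAddMonoidHom.comp Abelianization.of.toAdditive

variable {φ : F →* G} {hφ : Function.Surjective φ}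

theorem relationClass_surjective : Function.Surjective (relationClass φ hφ) :=
  (rep φ hφ).asModuleEquiv.symm.surjective.comp (QuotientGroup.mk'_surjective (commutator φ.ker))

theorem of_smul_relationClass (f : F) (r : φ.ker) :
    MonoidAlgebra.of ℤ G (φ f) • relationClass φ hφ (.ofMul r) =
      relationClass φ hφ (.ofMul (MulAut.conjNormal f r)) :=
  ((rep φ hφ).asModuleEquiv_symm_map_rho (φ f) _).symm.trans
    (congrArg (rep φ hφ).asModuleEquiv.symm (rep_apply_of φ hφ f r))

theorem span_relationClass_eq_top {S : Set φ.ker}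
    (hS : φ.ker ≤ Subgroup.normalClosure (Subtype.val '' S)) :
    Submodule.span (MonoidAlgebra ℤ G) ((fun r => relationClass φ hφ (.ofMul r)) '' S) = ⊤ := by
  set W := Submodule.span (MonoidAlgebra ℤ G) ((fun r => relationClass φ hφ (.ofMul r)) '' S)
  let K : Subgroup φ.ker :=
    Subgroup.toAddSubgroup.symm (W.toAddSubgroup.comap (relationClass φ hφ))
  have normal_K : (K.map φ.ker.subtype).Normal := by
    refine ⟨?_⟩
    rintro _ ⟨r, hr, rfl⟩ f
    refine ⟨MulAut.conjNormal f r, ?_, MulAut.conjNormal_apply f r⟩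
    change relationClass φ hφ (.ofMul (MulAut.conjNormal f r)) ∈ W
    rw [← of_smul_relationClass]
    exact W.smul_mem _ hr
  have ker_le : φ.ker ≤ K.map φ.ker.subtype := by
    refine hS.trans (Subgroup.normalClosure_le_normal ?_)
    rintro _ ⟨r, hr, rfl⟩
    exact ⟨r, Submodule.subset_span ⟨r, hr, rfl⟩, rfl⟩
  refine eq_top_iff.2 fun v _ => ?_
  obtain ⟨r, rfl⟩ := relationClass_surjective v
  obtain ⟨r', hr', h⟩ := ker_le r.toMul.2
  obtain rfl : r' = r.toMul := Subtype.ext h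
  exact hr'

theorem relationClass_commutator_pow {x c : F} {κ : φ.ker} (hκ : (κ : F) = ⁅c, x⁆) (k : ℕ) :
    ∃ r : φ.ker, (r : F) = ⁅c, x ^ k⁆ ∧ relationClass φ hφ (.ofMul r) =
      (∑ i ∈ Finset.range k, MonoidAlgebra.of ℤ G (φ x) ^ i) •
        relationClass φ hφ (.ofMul κ) := by
  induction k with
  | zero => exact ⟨1, by simp, by simp⟩
  | succ k ih =>
    obtain ⟨r, hr, hr'⟩ := ih
    refine ⟨r * MulAut.conjNormal (x ^ k) κ, ?_, ?_⟩
    · rw [Subgroup.coe_mul, MulAut.conjNormal_apply, hr, hκ, pow_succ,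
        commutatorElement_mul_right_eq_mul_conj]
      simp only [mul_assoc]
    · rw [ofMul_mul, map_add, ← of_smul_relationClass, hr', map_pow, map_pow,
        Finset.sum_range_succ, add_smul]

theorem isRelatorPair_relationClass {x c : F} {n : ℕ} {ρ κ : φ.ker} (hρ : (ρ : F) = x ^ n)
    (hκ : (κ : F) = ⁅c, x⁆) :
    IsRelatorPair n (MonoidAlgebra.of ℤ G (φ x)) (MonoidAlgebra.of ℤ G (φ c))
      (relationClass φ hφ (.ofMul ρ)) (relationClass φ hφ (.ofMul κ)) where
  pow_eq_one := by
    rw [← map_pow, ← map_pow, ← hρ, MonoidHom.mem_ker.1 ρ.2, map_one]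
  smul_power := by
    rw [of_smul_relationClass]
    congr
    ext
    rw [MulAut.conjNormal_apply, hρ, ← pow_succ', pow_succ, mul_inv_cancel_right]
  smul_power_eq_add := by
    obtain ⟨r, hr, hr'⟩ := relationClass_commutator_pow (hφ := hφ) hκ n
    rw [of_smul_relationClass, ← hr', ← map_add, ← ofMul_mul]
    congr
    ext
    rw [MulAut.conjNormal_apply, Subgroup.coe_mul, hr, hρ, ← conj_eq_commutatorElement_mul,
      MulAut.conj_apply]

end RelationClass

section InvariantCharacters

variable {F G F' G' : Type*} [Group F'] [Group G'] [Group F] [Group G]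

/-- The reduction modulo `n` of the augmentation `ℤ[G] → ℤ`. -/
noncomputable def augmentation (G : Type*) [Group G] (n : ℕ) : MonoidAlgebra ℤ G →+* ZMod n :=
  (MonoidAlgebra.lift ℤ (ZMod n) G 1).toRingHom

instance (n : ℕ) : RingHomSurjective (augmentation G n) := ⟨ZMod.ringHom_surjective _⟩

theorem map_smul_of_map_of_smul {n : ℕ} {M V : Type*} [AddCommGroup M]
    [Module (MonoidAlgebra ℤ G) M] [AddCommGroup V] [Module (ZMod n) V] {θ : M →+ V}
    (hθ : ∀ g v, θ (MonoidAlgebra.of ℤ G g • v) = θ v) (a : MonoidAlgebra ℤ G) (v : M) :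
    θ (a • v) = augmentation G n a • θ v := by
  induction a using MonoidAlgebra.induction_on with
  | of g => rw [hθ]; simp [augmentation]
  | add a b ha hb => rw [add_smul, map_add, map_add, add_smul, ha, hb]
  | smul t a ha => rw [smul_assoc, map_zsmul, map_zsmul, smul_assoc, ha]

theorem card_le_spanRank_top {n : ℕ} [Nontrivial (ZMod n)] {M ι : Type*} [AddCommGroup M]
    [Module (MonoidAlgebra ℤ G) M] [Fintype ι] (θ : M →ₛₗ[augmentation G n] (ι → ZMod n))
    (hθ : Function.Surjective θ) :
    (Fintype.card ι : Cardinal) ≤ (⊤ : Submodule (MonoidAlgebra ℤ G) M).spanRank := by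
  have h := Submodule.lift_spanRank_map_le θ ⊤
  rw [Submodule.map_top, LinearMap.range_eq_top.2 hθ, ← Submodule.rank_eq_spanRank_of_free,
    rank_fun'] at h
  simpa using h

/-- Invariance under conjugation in `F` of a homomorphism from the kernel `R` of `φ : F →* G`;
such homomorphisms to abelian groups are those that factor through `R / [F, R]`. -/
def IsConjInvariant (φ : F →* G) {A : Type*} [Group A] (χ : φ.ker →* A) : Prop :=
  ∀ f r, χ (MulAut.conjNormal f r) = χ r

theorem card_le_minGenerators {φ : F →* G} (hφ : Function.Surjective φ) {n : ℕ}
    [Nontrivial (ZMod n)] {ι : Type*} [Fintype ι] [DecidableEq ι]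
    {χ : ι → φ.ker →* Multiplicative (ZMod n)} (hχ : ∀ i, IsConjInvariant φ (χ i))
    {r : ι → φ.ker} (hr : ∀ i j, (χ i (r j)).toAdd = (1 : Matrix ι ι (ZMod n)) i j) :
    (Fintype.card ι : Cardinal) ≤ minGenerators φ hφ := by
  let ψ : Additive (Abelianization φ.ker) →+ (ι → ZMod n) := AddMonoidHom.pi fun i =>
    MonoidHom.toAdditiveLeft (Abelianization.lift (χ i))
  let θ : (rep φ hφ).asModule →+ (ι → ZMod n) :=
    ψ.comp (rep φ hφ).asModuleEquiv.toLinearMap.toAddMonoidHom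
  have θ_relationClass (r : φ.ker) (i : ι) :
      θ (relationClass φ hφ (.ofMul r)) i = (χ i r).toAdd := rfl
  have θ_invariant (g : G) (v) : θ (MonoidAlgebra.of ℤ G g • v) = θ v := by
    obtain ⟨f, rfl⟩ := hφ g
    obtain ⟨r, rfl⟩ := relationClass_surjective v
    ext i
    rw [← ofMul_toMul r, of_smul_relationClass, θ_relationClass, θ_relationClass, hχ]
  let θ' : (rep φ hφ).asModule →ₛₗ[augmentation G n] (ι → ZMod n) :=
    { θ with map_smul' := map_smul_of_map_of_smul θ_invariant }
  refine card_le_spanRank_top θ' (LinearMap.range_eq_top.1 (eq_top_iff.2 ?_))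
  rw [← (Pi.basisFun (ZMod n) ι).span_eq, Submodule.span_le]
  rintro _ ⟨j, rfl⟩
  refine ⟨relationClass φ hφ (.ofMul (r j)), funext fun i => (θ_relationClass (r j) i).trans ?_⟩
  rw [hr, Pi.basisFun_apply, Pi.single_apply, Matrix.one_apply]

/-- The homomorphism induced by `u` between the kernels of two presentations. -/
def kerMap {φ : F →* G} {φ' : F' →* G'} (u : F →* F') (hu : φ.ker ≤ φ'.ker.comap u) :
    φ.ker →* φ'.ker :=
  (u.subgroupComap φ'.ker).comp (Subgroup.inclusion hu)

@[simp]
theorem coe_kerMap {φ : F →* G} {φ' : F' →* G'} (u : F →* F') (hu : φ.ker ≤ φ'.ker.comap u)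
    (r : φ.ker) : (kerMap u hu r : F') = u r :=
  rfl

theorem IsConjInvariant.comp_kerMap {φ : F →* G} {φ' : F' →* G'} {A : Type*} [Group A]
    {χ : φ'.ker →* A} (hχ : IsConjInvariant φ' χ) (u : F →* F') (hu : φ.ker ≤ φ'.ker.comap u) :
    IsConjInvariant φ (χ.comp (kerMap u hu)) := fun f r => by
  have kerMap_conj : kerMap u hu (MulAut.conjNormal f r) =
      MulAut.conjNormal (u f) (kerMap u hu r) := by
    ext
    simp
  rw [MonoidHom.comp_apply, kerMap_conj, hχ, MonoidHom.comp_apply]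

end InvariantCharacters

section Coprod

open Monoid.Coprod

variable {F₁ F₂ H₁ H₂ : Type*} [Group F₁] [Group F₂] [Group H₁] [Group H₂]

section

variable (φ₁ : F₁ →* H₁) (φ₂ : F₂ →* H₂)

/-- The inclusion of the kernel of `φ₁` into the kernel of `φ₁ * φ₂`. -/
def inlKer : φ₁.ker →* (map φ₁ φ₂).ker :=
  kerMap inl fun r hr => by simp [MonoidHom.mem_ker.1 hr]

/-- The inclusion of the kernel of `φ₂` into the kernel of `φ₁ * φ₂`. -/
def inrKer : φ₂.ker →* (map φ₁ φ₂).ker :=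
  kerMap inr fun r hr => by simp [MonoidHom.mem_ker.1 hr]

/-- The projection of the kernel of `φ₁ * φ₂` to the kernel of `φ₁`. -/
def fstKer : (map φ₁ φ₂).ker →* φ₁.ker :=
  kerMap fst fun r hr => by
    have fst_map : φ₁.comp fst = fst.comp (map φ₁ φ₂) := hom_ext rfl (by ext; simp)
    exact (DFunLike.congr_fun fst_map r).trans (by simp [MonoidHom.mem_ker.1 hr])

/-- The projection of the kernel of `φ₁ * φ₂` to the kernel of `φ₂`. -/
def sndKer : (map φ₁ φ₂).ker →* φ₂.ker :=
  kerMap snd fun r hr => by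
    have snd_map : φ₂.comp snd = snd.comp (map φ₁ φ₂) := hom_ext (by ext; simp) rfl
    exact (DFunLike.congr_fun snd_map r).trans (by simp [MonoidHom.mem_ker.1 hr])

@[simp]
theorem fstKer_inlKer (r : φ₁.ker) : fstKer φ₁ φ₂ (inlKer φ₁ φ₂ r) = r :=
  Subtype.ext (fst_apply_inl _)

@[simp]
theorem fstKer_inrKer (r : φ₂.ker) : fstKer φ₁ φ₂ (inrKer φ₁ φ₂ r) = 1 :=
  Subtype.ext (fst_apply_inr _)

@[simp]
theorem sndKer_inlKer (r : φ₁.ker) : sndKer φ₁ φ₂ (inlKer φ₁ φ₂ r) = 1 :=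
  Subtype.ext (snd_apply_inl _)

@[simp]
theorem sndKer_inrKer (r : φ₂.ker) : sndKer φ₁ φ₂ (inrKer φ₁ φ₂ r) = r :=
  Subtype.ext (snd_apply_inr _)

end

theorem ker_map_le_normalClosure {φ₁ : F₁ →* H₁} {φ₂ : F₂ →* H₂}
    (hφ₁ : Function.Surjective φ₁) (hφ₂ : Function.Surjective φ₂) {S₁ : Set F₁} {S₂ : Set F₂}
    (hS₁ : φ₁.ker ≤ Subgroup.normalClosure S₁) (hS₂ : φ₂.ker ≤ Subgroup.normalClosure S₂) :
    (map φ₁ φ₂).ker ≤ Subgroup.normalClosure (inl '' S₁ ∪ inr '' S₂) := by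
  set N := Subgroup.normalClosure (inl '' S₁ ∪ inr '' S₂ : Set (Monoid.Coprod F₁ F₂))
  let π : Monoid.Coprod F₁ F₂ →* Monoid.Coprod F₁ F₂ ⧸ N := QuotientGroup.mk' N
  have ker_inl : φ₁.ker ≤ (π.comp inl).ker := hS₁.trans <| Subgroup.normalClosure_le_normal
    fun r hr => (QuotientGroup.eq_one_iff _).2
      (Subgroup.subset_normalClosure (.inl ⟨r, hr, rfl⟩))
  have ker_inr : φ₂.ker ≤ (π.comp inr).ker := hS₂.trans <| Subgroup.normalClosure_le_normal
    fun r hr => (QuotientGroup.eq_one_iff _).2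
      (Subgroup.subset_normalClosure (.inr ⟨r, hr, rfl⟩))
  let σ : Monoid.Coprod H₁ H₂ →* Monoid.Coprod F₁ F₂ ⧸ N := lift
    (φ₁.liftOfSurjective hφ₁ ⟨_, ker_inl⟩) (φ₂.liftOfSurjective hφ₂ ⟨_, ker_inr⟩)
  have σ_comp_map : σ.comp (map φ₁ φ₂) = π := hom_ext
    (φ₁.liftOfRightInverse_comp _ (Function.rightInverse_surjInv hφ₁) ⟨_, ker_inl⟩)
    (φ₂.liftOfRightInverse_comp _ (Function.rightInverse_surjInv hφ₂) ⟨_, ker_inr⟩)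
  intro r hr
  rw [← QuotientGroup.eq_one_iff]
  change π r = 1
  rw [← σ_comp_map, MonoidHom.comp_apply, MonoidHom.mem_ker.1 hr, map_one]

end Coprod

/-- The exponent sum of the generator `a` in a word. -/
def exponentSum {α : Type*} [DecidableEq α] (a : α) : FreeGroup α →* Multiplicative ℤ :=
  FreeGroup.lift (Pi.mulSingle a (Multiplicative.ofAdd 1))

/-- The Heisenberg group over a commutative ring: `⟨a, b, z⟩` stands for the upper unitriangular
`3 × 3` matrix with entries `a`, `b` above the diagonal and `z` in the corner. -/
@[ext]
structure Heisenberg (k : Type*) where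
  a : k
  b : k
  z : k

namespace Heisenberg

variable {k : Type*} [CommRing k]

instance : One (Heisenberg k) := ⟨⟨0, 0, 0⟩⟩
instance : Mul (Heisenberg k) := ⟨fun s t => ⟨s.a + t.a, s.b + t.b, s.z + t.z + s.a * t.b⟩⟩
instance : Inv (Heisenberg k) := ⟨fun s => ⟨-s.a, -s.b, -s.z + s.a * s.b⟩⟩

@[simp] theorem one_a : (1 : Heisenberg k).a = 0 := rfl
@[simp] theorem one_b : (1 : Heisenberg k).b = 0 := rfl
@[simp] theorem one_z : (1 : Heisenberg k).z = 0 := rfl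
@[simp] theorem mul_a (s t : Heisenberg k) : (s * t).a = s.a + t.a := rfl
@[simp] theorem mul_b (s t : Heisenberg k) : (s * t).b = s.b + t.b := rfl
@[simp] theorem mul_z (s t : Heisenberg k) : (s * t).z = s.z + t.z + s.a * t.b := rfl
@[simp] theorem inv_a (s : Heisenberg k) : s⁻¹.a = -s.a := rfl
@[simp] theorem inv_b (s : Heisenberg k) : s⁻¹.b = -s.b := rfl
@[simp] theorem inv_z (s : Heisenberg k) : s⁻¹.z = -s.z + s.a * s.b := rfl

instance : Group (Heisenberg k) :=
  Group.ofLeftAxioms (fun s t u => by ext <;> simp <;> ring) (fun s => by ext <;> simp)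
    (fun s => by ext <;> simp)

theorem pow_z_of_a_eq_zero {s : Heisenberg k} (hs : s.a = 0) (n : ℕ) : (s ^ n).z = n • s.z := by
  induction n with
  | zero => simp
  | succ n ih => rw [pow_succ', mul_z, ih, hs, zero_mul, add_zero, succ_nsmul']

theorem conj_z {s : Heisenberg k} (ha : s.a = 0) (hb : s.b = 0) (t : Heisenberg k) :
    (t * s * t⁻¹).z = s.z := by
  simp only [mul_z, mul_a, inv_z, inv_b, ha, hb]
  ring

/-- The homomorphism to the Heisenberg group that sends the first free generator to `⟨0, 1, 0⟩`
and the second to `⟨1, 0, 0⟩`, so that the commutator of the second with the first becomes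
`⟨0, 0, 1⟩`. -/
def ofFreeGroup (k : Type*) [CommRing k] : FreeGroup (Fin 2) →* Heisenberg k :=
  FreeGroup.lift ![⟨0, 1, 0⟩, ⟨1, 0, 0⟩]

theorem ofFreeGroup_a (w : FreeGroup (Fin 2)) :
    (ofFreeGroup k w).a = ((exponentSum 1 w).toAdd : k) := by
  induction w using FreeGroup.induction_on with
  | C1 => simp
  | of i => fin_cases i <;> simp [ofFreeGroup, exponentSum]
  | inv_of i ih => simp [ih]
  | mul v w hv hw => simp [hv, hw]

theorem ofFreeGroup_b (w : FreeGroup (Fin 2)) :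
    (ofFreeGroup k w).b = ((exponentSum 0 w).toAdd : k) := by
  induction w using FreeGroup.induction_on with
  | C1 => simp
  | of i => fin_cases i <;> simp [ofFreeGroup, exponentSum]
  | inv_of i ih => simp [ih]
  | mul v w hv hw => simp [hv, hw]

end Heisenberg

section Factor

open FreeGroup

theorem map_eq_zpow_mul_zpow {Q : Type*} [Group Q] {u : FreeGroup (Fin 2) →* Q}
    (hu : Commute (u (of 0)) (u (of 1))) (w : FreeGroup (Fin 2)) :
    u w = u (of 0) ^ (exponentSum 0 w).toAdd * u (of 1) ^ (exponentSum 1 w).toAdd := by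
  have commute_powers (i j : Multiplicative ℤ) :
      Commute (zpowersHom Q (u (of 0)) i) (zpowersHom Q (u (of 1)) j) := hu.zpow_zpow _ _
  have u_eq : u = (MonoidHom.noncommCoprod _ _ commute_powers).comp
      ((exponentSum 0).prod (exponentSum 1)) := by
    ext i
    fin_cases i <;> simp [exponentSum, MonoidHom.noncommCoprod_apply]
  exact DFunLike.congr_fun u_eq w

variable {A C : Type*} [Group A] [Group C]

theorem mem_ker_factorHom_iff {x : A} {c : C} {w : FreeGroup (Fin 2)} :
    w ∈ (factorHom x c).ker ↔
      (orderOf x : ℤ) ∣ (exponentSum 0 w).toAdd ∧ (orderOf c : ℤ) ∣ (exponentSum 1 w).toAdd := by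
  have commute_generators : Commute (factorHom x c (of 0)) (factorHom x c (of 1)) := by
    simp [factorHom, Prod.commute_iff]
  rw [MonoidHom.mem_ker, map_eq_zpow_mul_zpow commute_generators, orderOf_dvd_iff_zpow_eq_one,
    orderOf_dvd_iff_zpow_eq_one]
  simp [factorHom]

/-- The relator `Xⁿ`, with `n` the order of `x`, of the presentation `factorHom x c`. -/
noncomputable def powerRelator (x : A) (c : C) : (factorHom x c).ker :=
  ⟨of 0 ^ orderOf x, mem_ker_factorHom_iff.2 (by simp [exponentSum])⟩

/-- The relator `[Y, X]` of the presentation `factorHom x c`. -/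
def commutatorRelator (x : A) (c : C) : (factorHom x c).ker :=
  ⟨⁅(of 1 : FreeGroup (Fin 2)), of 0⁆,
    mem_ker_factorHom_iff.2 (by simp [commutatorElement_def])⟩

theorem ker_factorHom_le_normalClosure {x : A} {c : C} (hc : orderOf c = 0) :
    (factorHom x c).ker ≤
      Subgroup.normalClosure {↑(powerRelator x c), ↑(commutatorRelator x c)} := by
  set N := Subgroup.normalClosure
    ({↑(powerRelator x c), ↑(commutatorRelator x c)} : Set (FreeGroup (Fin 2)))
  let π := QuotientGroup.mk' N
  have π_pow : π (of 0) ^ orderOf x = 1 :=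
    (QuotientGroup.eq_one_iff _).2 (Subgroup.subset_normalClosure (.inl rfl))
  have π_commutator : π ⁅(of 1 : FreeGroup (Fin 2)), of 0⁆ = 1 :=
    (QuotientGroup.eq_one_iff _).2 (Subgroup.subset_normalClosure (.inr rfl))
  have π_commute : Commute (π (of 0)) (π (of 1)) := by
    rw [map_commutatorElement, commutatorElement_eq_one_iff_commute] at π_commutator
    exact π_commutator.symm
  intro w hw
  obtain ⟨⟨k, exponentSum_zero⟩, exponentSum_one⟩ := mem_ker_factorHom_iff.1 hw
  rw [hc, Nat.cast_zero, zero_dvd_iff] at exponentSum_one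
  rw [← QuotientGroup.eq_one_iff]
  change π w = 1
  rw [map_eq_zpow_mul_zpow π_commute, exponentSum_zero, exponentSum_one, zpow_mul, zpow_natCast,
    π_pow, one_zpow, zpow_zero, mul_one]

/-- The character of the kernel of `factorHom x c` detecting the relator `Xⁿ`: the exponent sum of
`X` divided by the order `n` of `x`. The division is exact on the kernel, and it yields `0` when
`x` has infinite order. -/
noncomputable def powerCharacter (k : Type*) [Ring k] (x : A) (c : C) :
    (factorHom x c).ker →* Multiplicative k :=
  MonoidHom.mk'
    (fun r => .ofAdd (((exponentSum 0 (r : FreeGroup (Fin 2))).toAdd / orderOf x : ℤ) : k))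
    fun r s => by
      simp [Int.add_ediv_of_dvd_left (mem_ker_factorHom_iff.1 r.2).1, ofAdd_add]

theorem ofFreeGroup_a_of_mem_ker {k : Type*} [CommRing k] {x : A} {c : C} (hc : orderOf c = 0)
    {w : FreeGroup (Fin 2)} (hw : w ∈ (factorHom x c).ker) :
    (Heisenberg.ofFreeGroup k w).a = 0 := by
  have dvd := (mem_ker_factorHom_iff.1 hw).2
  rw [hc, Nat.cast_zero, zero_dvd_iff] at dvd
  rw [Heisenberg.ofFreeGroup_a, dvd, Int.cast_zero]

/-- The character of the kernel of `factorHom x c` detecting the relator `[Y, X]`: the corner entry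
of the image in the Heisenberg group. -/
def commutatorCharacter (k : Type*) [CommRing k] (x : A) {c : C} (hc : orderOf c = 0) :
    (factorHom x c).ker →* Multiplicative k :=
  MonoidHom.mk' (fun r => .ofAdd (Heisenberg.ofFreeGroup k r).z) fun r s => by
    simp [ofFreeGroup_a_of_mem_ker hc r.2, ofAdd_add]

theorem powerCharacter_isConjInvariant (k : Type*) [Ring k] (x : A) (c : C) :
    IsConjInvariant (factorHom x c) (powerCharacter k x c) := fun f r => by
  simp [powerCharacter]

theorem commutatorCharacter_isConjInvariant (x : A) {c : C} (hc : orderOf c = 0) :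
    IsConjInvariant (factorHom x c) (commutatorCharacter (ZMod (orderOf x)) x hc) := fun f r => by
  have b_eq_zero : (Heisenberg.ofFreeGroup (ZMod (orderOf x)) r).b = 0 := by
    rw [Heisenberg.ofFreeGroup_b, ZMod.intCast_zmod_eq_zero_iff_dvd]
    exact (mem_ker_factorHom_iff.1 r.2).1
  simp [commutatorCharacter, Heisenberg.conj_z (ofFreeGroup_a_of_mem_ker hc r.2) b_eq_zero]

theorem powerCharacter_powerRelator (k : Type*) [Ring k] {x : A} (hx : orderOf x ≠ 0) (c : C) :
    powerCharacter k x c (powerRelator x c) = .ofAdd 1 := by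
  simp [powerCharacter, powerRelator, exponentSum, hx]

theorem powerCharacter_commutatorRelator (k : Type*) [Ring k] (x : A) (c : C) :
    powerCharacter k x c (commutatorRelator x c) = 1 := by
  simp [powerCharacter, commutatorRelator, commutatorElement_def]

theorem commutatorCharacter_powerRelator (k : Type*) [CommRing k] (x : A) {c : C}
    (hc : orderOf c = 0) : commutatorCharacter k x hc (powerRelator x c) = 1 := by
  simp [commutatorCharacter, powerRelator, Heisenberg.ofFreeGroup, Heisenberg.pow_z_of_a_eq_zero]

theorem commutatorCharacter_commutatorRelator (k : Type*) [CommRing k] (x : A) {c : C}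
    (hc : orderOf c = 0) : commutatorCharacter k x hc (commutatorRelator x c) = .ofAdd 1 := by
  simp [commutatorCharacter, commutatorRelator, Heisenberg.ofFreeGroup, commutatorElement_def]

end Factor

section FreeProduct

variable {G₁ G₂ C₁ C₂ : Type*} [Group G₁] [Group G₂] [Group C₁] [Group C₂]
  {x₁ : G₁} {c₁ : C₁} {x₂ : G₂} {c₂ : C₂}

theorem minGenerators_le_three (h₁ : Function.Surjective (factorHom x₁ c₁))
    (h₂ : Function.Surjective (factorHom x₂ c₂)) (hcop : (orderOf x₁).Coprime (orderOf x₂))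
    (hc₁ : orderOf c₁ = 0) (hc₂ : orderOf c₂ = 0) :
    minGenerators _ (coprodMap_surjective h₁ h₂) ≤ 3 := by
  let ι₁ := inlKer (factorHom x₁ c₁) (factorHom x₂ c₂)
  let ι₂ := inrKer (factorHom x₁ c₁) (factorHom x₂ c₂)
  let S : Set (Monoid.Coprod.map (factorHom x₁ c₁) (factorHom x₂ c₂)).ker :=
    {ι₁ (powerRelator x₁ c₁), ι₁ (commutatorRelator x₁ c₁),
      ι₂ (powerRelator x₂ c₂), ι₂ (commutatorRelator x₂ c₂)}
  have ker_le : (Monoid.Coprod.map (factorHom x₁ c₁) (factorHom x₂ c₂)).ker ≤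
      Subgroup.normalClosure (Subtype.val '' S) := by
    refine (ker_map_le_normalClosure h₁ h₂ (ker_factorHom_le_normalClosure hc₁)
      (ker_factorHom_le_normalClosure hc₂)).trans (Subgroup.normalClosure_mono ?_)
    simp [S, Set.image_insert_eq, Set.insert_subset_iff, ι₁, ι₂, inlKer, inrKer, powerRelator,
      commutatorRelator]
  have pair₁ : IsRelatorPair (orderOf x₁) _ _ _ _ :=
    isRelatorPair_relationClass (hφ := coprodMap_surjective h₁ h₂)
      (ρ := ι₁ (powerRelator x₁ c₁)) (κ := ι₁ (commutatorRelator x₁ c₁))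
      (map_pow Monoid.Coprod.inl _ _) (map_commutatorElement Monoid.Coprod.inl _ _)
  have pair₂ : IsRelatorPair (orderOf x₂) _ _ _ _ :=
    isRelatorPair_relationClass (hφ := coprodMap_surjective h₁ h₂)
      (ρ := ι₂ (powerRelator x₂ c₂)) (κ := ι₂ (commutatorRelator x₂ c₂))
      (map_pow Monoid.Coprod.inr _ _) (map_commutatorElement Monoid.Coprod.inr _ _)
  refine pair₁.spanRank_le_three pair₂ ((Group.isUnit _).map _) hcop ?_
  simpa only [S, Set.image_insert_eq, Set.image_singleton] using span_relationClass_eq_top ker_le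

theorem three_le_minGenerators
    (h : Function.Surjective (Monoid.Coprod.map (factorHom x₁ c₁) (factorHom x₂ c₂)))
    (hx₁ : orderOf x₁ ≠ 0) (hx₁' : orderOf x₁ ≠ 1) (hx₂ : orderOf x₂ ≠ 0) (hc₁ : orderOf c₁ = 0) :
    3 ≤ minGenerators _ h := by
  have : Nontrivial (ZMod (orderOf x₁)) := ZMod.nontrivial_iff.2 hx₁'
  let π₁ := fstKer (factorHom x₁ c₁) (factorHom x₂ c₂)
  let π₂ := sndKer (factorHom x₁ c₁) (factorHom x₂ c₂)
  let ι₁ := inlKer (factorHom x₁ c₁) (factorHom x₂ c₂)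
  let ι₂ := inrKer (factorHom x₁ c₁) (factorHom x₂ c₂)
  let χ : Fin 3 → _ →* Multiplicative (ZMod (orderOf x₁)) :=
    ![(powerCharacter _ x₁ c₁).comp π₁, (powerCharacter _ x₂ c₂).comp π₂,
      (commutatorCharacter _ x₁ hc₁).comp π₁]
  let r := ![ι₁ (powerRelator x₁ c₁), ι₂ (powerRelator x₂ c₂), ι₁ (commutatorRelator x₁ c₁)]
  have χ_isConjInvariant (i) : IsConjInvariant _ (χ i) := by
    fin_cases i
    · exact (powerCharacter_isConjInvariant _ x₁ c₁).comp_kerMap _ _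
    · exact (powerCharacter_isConjInvariant _ x₂ c₂).comp_kerMap _ _
    · exact (commutatorCharacter_isConjInvariant x₁ hc₁).comp_kerMap _ _
  have χ_r (i j) : (χ i (r j)).toAdd = (1 : Matrix (Fin 3) (Fin 3) (ZMod (orderOf x₁))) i j := by
    fin_cases i <;> fin_cases j <;>
      simp [χ, r, π₁, π₂, ι₁, ι₂, hx₁, hx₂, powerCharacter_powerRelator,
        powerCharacter_commutatorRelator, commutatorCharacter_powerRelator,
        commutatorCharacter_commutatorRelator]
  simpa using card_le_minGenerators h χ_isConjInvariant χ_r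

end FreeProduct

end RelationModule

theorem proposition1p2 {G₁ G₂ C₁ C₂ : Type*} [Group G₁] [Group G₂] [Group C₁] [Group C₂]
    [Finite G₁] [Finite G₂] [Nontrivial G₁] [Nontrivial G₂] [Infinite C₁] [Infinite C₂]
    (hcop : (Nat.card G₁).Coprime (Nat.card G₂))
    (x₁ : G₁) (hx₁ : Subgroup.zpowers x₁ = ⊤) (c₁ : C₁) (hc₁ : Subgroup.zpowers c₁ = ⊤)
    (x₂ : G₂) (hx₂ : Subgroup.zpowers x₂ = ⊤) (c₂ : C₂) (hc₂ : Subgroup.zpowers c₂ = ⊤) :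
    RelationModule.minGenerators
      (Monoid.Coprod.map (RelationModule.factorHom x₁ c₁) (RelationModule.factorHom x₂ c₂))
      (RelationModule.coprodMap_surjective
        (RelationModule.factorHom_surjective hx₁ hc₁)
        (RelationModule.factorHom_surjective hx₂ hc₂)) = 3 := by
  have orderOf_c₁ : orderOf c₁ = 0 := by
    rw [orderOf_eq_card_of_zpowers_eq_top hc₁, Nat.card_eq_zero_of_infinite]
  have orderOf_c₂ : orderOf c₂ = 0 := by
    rw [orderOf_eq_card_of_zpowers_eq_top hc₂, Nat.card_eq_zero_of_infinite]
  have orderOf_x₁_ne_one : orderOf x₁ ≠ 1 := by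
    rw [orderOf_eq_card_of_zpowers_eq_top hx₁]
    exact Finite.one_lt_card.ne'
  have h₁ := RelationModule.factorHom_surjective hx₁ hc₁
  have h₂ := RelationModule.factorHom_surjective hx₂ hc₂
  have orders_coprime : (orderOf x₁).Coprime (orderOf x₂) := by
    rwa [orderOf_eq_card_of_zpowers_eq_top hx₁, orderOf_eq_card_of_zpowers_eq_top hx₂]
  exact le_antisymm
    (RelationModule.minGenerators_le_three h₁ h₂ orders_coprime orderOf_c₁ orderOf_c₂)
    (RelationModule.three_le_minGenerators _ (orderOf_pos x₁).ne' orderOf_x₁_ne_one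
      (orderOf_pos x₂).ne' orderOf_c₁)
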